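/- Let $q$ be a prime power, let $\mathbb F_q$ be the field with $q$ elements and let $n$ be a positive integer. The functional graph of an $\mathbb F_q$-linear map $T:\mathbb F_q^n\to\mathbb F_q^n$ is the directed graph with vertex set $\mathbb F_q^n$ and edges $v\to T(v)$ for $v\in\mathbb F_q^n$. Let $A_q(n)$ be the number of pairwise non-isomorphic directed graphs that arise in this way. Let $\mathcal P_n$ be the set of all nonzero vectors $\lambda=(\lambda_1,\ldots,\lambda_n)$ of nonnegative integers with $\sum_{i=1}^n i\,\lambda_i\le n$. For $i\ge 1$ let $\sigma_i$ be the number of positive divisors of $q^i-1$, and let $\sigma_i^*$ be the number of positive integers $e$ such that $i=\min\{j>0 : q^j\equiv 1\pmod e\}$. Then $$\sum_{\lambda\in\mathcal P_n}\prod_{i=1}^n\binom{\sigma_i^*+\lambda_i-1}{\lambda_i}\;\le\; A_q(n)\;\le\; 2^{4\sqrt n}\cdot\sum_{\lambda\in\mathcal P_n}\prod_{i=1}^n\binom{\sigma_i+\lambda_i-1}{\lambda_i}.$$ -/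

import Mathlib

/-- The functional graph of a map `f : V → V`: the directed graph on `V` (loops allowed)
whose edges are exactly `v → f v`. -/
def functionalGraph {V : Type*} (f : V → V) : Digraph V where
  Adj v w := f v = w

/-- Isomorphism of directed graphs: a bijection of the vertex sets that preserves and reflects
the edge relation. -/
def Digraph.IsIsomorphic {V W : Type*} (G : Digraph V) (H : Digraph W) : Prop :=
  Nonempty (G.Adj ≃r H.Adj)

/-- Two linear endomorphisms of `F ^ n` are identified when their functional graphs are
isomorphic. -/
def functionalGraphSetoid (F : Type*) [Field F] (n : ℕ) :
    Setoid ((Fin n → F) →ₗ[F] (Fin n → F)) where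
  r S T := (functionalGraph S).IsIsomorphic (functionalGraph T)
  iseqv :=
    { refl := fun _ => ⟨RelIso.refl _⟩
      symm := fun ⟨e⟩ => ⟨e.symm⟩
      trans := fun ⟨e⟩ ⟨e'⟩ => ⟨e.trans e'⟩ }

/-- The number of pairwise non-isomorphic functional graphs of linear maps `F ^ n → F ^ n`. -/
noncomputable def numFunctionalGraphs (F : Type*) [Field F] (n : ℕ) : ℕ :=
  Nat.card (Quotient (functionalGraphSetoid F n))

/-- The number of positive divisors of `q ^ i - 1`. -/
def numDivisors (q i : ℕ) : ℕ := (q ^ i - 1).divisors.card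

/-- The number of positive integers `e` such that `i` is the order of `q` modulo `e`, that is,
`i = min {j > 0 | q ^ j ≡ 1 (mod e)}`. -/
noncomputable def numModuliOfOrder (q i : ℕ) : ℕ :=
  Set.ncard {e : ℕ | 0 < e ∧ IsLeast {j : ℕ | 0 < j ∧ q ^ j ≡ 1 [MOD e]} i}

/-- The nonzero vectors `(lam_1, …, lam_n)` of natural numbers with `∑ i * lam_i ≤ n`. The entry
`lam_i` is `lam k` with `i = k + 1`. The bound on the entries only serves to make the
collection a `Finset`; it follows from the inequality, see `mem_boundedWeightVectors`. -/
def boundedWeightVectors (n : ℕ) : Finset (Fin n → ℕ) :=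
  (Fintype.piFinset fun _ : Fin n => Finset.range (n + 1)).filter
    fun lam => lam ≠ 0 ∧ ∑ k : Fin n, lam k * ((k : ℕ) + 1) ≤ n

theorem mem_boundedWeightVectors {n : ℕ} {lam : Fin n → ℕ} :
    lam ∈ boundedWeightVectors n ↔ lam ≠ 0 ∧ ∑ k : Fin n, lam k * ((k : ℕ) + 1) ≤ n := by
  unfold boundedWeightVectors
  rw [Finset.mem_filter, and_iff_right_iff_imp]
  rintro ⟨-, h⟩
  rw [Fintype.mem_piFinset]
  intro k
  have h1 := Finset.single_le_sum (f := fun k : Fin n => lam k * ((k : ℕ) + 1))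
    (fun _ _ => Nat.zero_le _) (Finset.mem_univ k)
  have h2 : lam k ≤ lam k * ((k : ℕ) + 1) := Nat.le_mul_of_pos_right _ (Nat.succ_pos _)
  rw [Finset.mem_range]
  exact Nat.lt_succ_of_le (h2.trans (h1.trans h))

/-!
Decompose `F ^ n` under `T` into blocks `F[X] / (f ^ a)` with `f` irreducible and `X` acting by
multiplication. Two blocks of equal dimension on which the root of `f` has the same order (`0` when
`f = X`) are conjugate as plain maps: nilpotent ones are linearly conjugate, and invertible ones are
permutations with the same number of points of every period, because `X ^ m - 1` is a power of the
characteristic times a squarefree factor. The graph is therefore determined by the partition formed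
by the nilpotent dimensions and, for every `i`, a multiset of divisors of `q ^ i - 1`, the orders of
the invertible blocks of dimension `i`. The number of partitions is at most `exp (π √(2 m / 3))`.

For the lower bound, a modulus `e` for which `q` has order `i` is the order of an element of the
extension of `F` of degree `i`. For a direct sum of multiplications by such elements, extended by
zero, the number of points of period `m` is `q` to the sum of the degrees `i` of the blocks with
`e ∣ m`, and inverting this divisor sum recovers the multiset of blocks from the graph.
-/

open Function Polynomial

section PeriodicPoints

variable {X Y : Type*}

theorem eq_of_sum_divisors_eq {M : Type*} [AddCancelCommMonoid M] {f g : ℕ → M}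
    (h : ∀ m, 0 < m → ∑ d ∈ m.divisors, f d = ∑ d ∈ m.divisors, g d) {m : ℕ} (hm : 0 < m) :
    f m = g m := by
  induction m using Nat.strong_induction_on with
  | _ m ih =>
    have hproper : ∑ d ∈ m.properDivisors, f d = ∑ d ∈ m.properDivisors, g d :=
      Finset.sum_congr rfl fun d hd =>
        ih d (Nat.mem_properDivisors.1 hd).2 (Nat.pos_of_mem_properDivisors hd)
    have hsum := h m hm
    rw [← Nat.cons_self_properDivisors hm.ne', Finset.sum_cons, Finset.sum_cons, hproper] at hsum
    exact add_right_cancel hsum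

theorem natCard_ptsOfPeriod [Finite X] (f : X → X) {m : ℕ} (hm : 0 < m) :
    Nat.card (ptsOfPeriod f m) = ∑ d ∈ m.divisors, Nat.card {x // minimalPeriod f x = d} := by
  classical
  have := Fintype.ofFinite X
  have hmem : ∀ x ∈ ({x | IsPeriodicPt f m x} : Finset X), minimalPeriod f x ∈ m.divisors :=
    fun x hx => Nat.mem_divisors.2 ⟨(Finset.mem_filter.1 hx).2.minimalPeriod_dvd, hm.ne'⟩
  rw [Nat.subtype_card {x | IsPeriodicPt f m x} (by simp [mem_ptsOfPeriod]),
    Finset.card_eq_sum_card_fiberwise hmem]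
  refine Finset.sum_congr rfl fun d hd => (Nat.subtype_card _ fun x => ?_).symm
  simp only [Finset.mem_filter, Finset.mem_univ, true_and, and_iff_right_iff_imp]
  rintro rfl
  exact isPeriodicPt_iff_minimalPeriod_dvd.2 (Nat.dvd_of_mem_divisors hd)

theorem natCard_ptsOfPeriod_eq_of_semiconj {f : X → X} {g : Y → Y} {e : X ≃ Y}
    (h : Semiconj e f g) (m : ℕ) :
    Nat.card (ptsOfPeriod f m) = Nat.card (ptsOfPeriod g m) :=
  Nat.card_congr <| e.subtypeEquiv fun x => by
    rw [mem_ptsOfPeriod, mem_ptsOfPeriod, IsPeriodicPt, IsPeriodicPt, IsFixedPt, IsFixedPt,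
      ← (h.iterate_right m).eq, e.apply_eq_iff_eq]

section Perm

open Equiv.Perm

theorem card_support_cycleOf_eq_minimalPeriod [Fintype X] [DecidableEq X] (σ : Equiv.Perm X)
    {x : X} (hx : σ x ≠ x) : (σ.cycleOf x).support.card = minimalPeriod σ x := by
  have hdvd : ∀ m, IsPeriodicPt σ m x ↔ (σ.cycleOf x).support.card ∣ m := fun m => by
    rw [IsPeriodicPt, IsFixedPt, iterate_eq_pow]
    exact (isCycleOn_support_cycleOf σ x).pow_apply_eq
      (by rwa [Equiv.Perm.mem_support, cycleOf_apply_self])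
  exact Nat.dvd_antisymm ((hdvd _).1 (isPeriodicPt_minimalPeriod σ x))
    ((hdvd _).2 dvd_rfl).minimalPeriod_dvd

theorem minimalPeriod_eq_card_support [Fintype X] [DecidableEq X] {σ τ : Equiv.Perm X}
    (hτ : τ ∈ σ.cycleFactorsFinset) {x : X} (hx : x ∈ τ.support) :
    minimalPeriod σ x = τ.support.card := by
  rw [(eq_cycleOf_of_mem_cycleFactorsFinset_iff σ τ hτ x).2 hx,
    card_support_cycleOf_eq_minimalPeriod]
  exact Equiv.Perm.mem_support.1 (mem_cycleFactorsFinset_support_le hτ hx)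

theorem natCard_minimalPeriod_eq [Fintype X] [DecidableEq X] (σ : Equiv.Perm X) {d : ℕ}
    (hd : 2 ≤ d) : Nat.card {x // minimalPeriod σ x = d} = d * σ.cycleType.count d := by
  have hcount : σ.cycleType.count d = {τ ∈ σ.cycleFactorsFinset | τ.support.card = d}.card := by
    rw [cycleType_def, Multiset.count_map, Finset.card_def, Finset.filter_val]
    simp only [Function.comp_apply, eq_comm]
  have hunion : ∀ x, x ∈ {τ ∈ σ.cycleFactorsFinset | τ.support.card = d}.biUnion support ↔
      minimalPeriod σ x = d := by
    intro x
    simp only [Finset.mem_biUnion, Finset.mem_filter]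
    refine ⟨?_, fun h => ?_⟩
    · rintro ⟨τ, ⟨hτ, rfl⟩, hx⟩
      exact minimalPeriod_eq_card_support hτ hx
    · have hx : σ x ≠ x := fun hfix => by
        have := IsPeriodicPt.minimalPeriod_le one_pos (IsFixedPt.isPeriodicPt hfix 1)
        omega
      have hcycle := cycleOf_mem_cycleFactorsFinset_iff.2 (Equiv.Perm.mem_support.2 hx)
      refine ⟨σ.cycleOf x, ⟨hcycle, ?_⟩, ?_⟩
      · rw [card_support_cycleOf_eq_minimalPeriod σ hx, h]
      · rwa [Equiv.Perm.mem_support, cycleOf_apply_self]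
  rw [Nat.subtype_card _ hunion, Finset.card_biUnion, hcount, mul_comm]
  · exact Finset.sum_const_nat fun τ hτ => (Finset.mem_filter.1 hτ).2
  · intro τ hτ τ' hτ' hne
    exact (σ.cycleFactorsFinset_pairwise_disjoint (Finset.mem_filter.1 hτ).1
      (Finset.mem_filter.1 hτ').1 hne).disjoint_support

theorem isConj_of_natCard_ptsOfPeriod_eq [Finite X] {σ τ : Equiv.Perm X}
    (h : ∀ m, 0 < m → Nat.card (ptsOfPeriod σ m) = Nat.card (ptsOfPeriod τ m)) : IsConj σ τ := by
  classical
  have := Fintype.ofFinite X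
  rw [isConj_iff_cycleType_eq]
  ext d
  by_cases hd : 2 ≤ d
  · have hperiod : Nat.card {x // minimalPeriod σ x = d} = Nat.card {x // minimalPeriod τ x = d} :=
      eq_of_sum_divisors_eq (f := fun d => Nat.card {x // minimalPeriod σ x = d})
        (g := fun d => Nat.card {x // minimalPeriod τ x = d})
        (fun m hm => by rw [← natCard_ptsOfPeriod _ hm, ← natCard_ptsOfPeriod _ hm, h m hm])
        (by omega)
    rw [natCard_minimalPeriod_eq _ hd, natCard_minimalPeriod_eq _ hd] at hperiod
    exact Nat.eq_of_mul_eq_mul_left (by omega) hperiod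
  · rw [Multiset.count_eq_zero_of_notMem fun h => hd (two_le_of_mem_cycleType h),
      Multiset.count_eq_zero_of_notMem fun h => hd (two_le_of_mem_cycleType h)]

theorem ptsOfPeriod_eq_univ_of_orderOf_dvd {σ : Equiv.Perm X} {m : ℕ} (h : orderOf σ ∣ m) :
    ptsOfPeriod σ m = Set.univ :=
  Set.eq_univ_of_forall fun x => by
    rw [mem_ptsOfPeriod, IsPeriodicPt, IsFixedPt, iterate_eq_pow,
      orderOf_dvd_iff_pow_eq_one.1 h, one_apply]

theorem natCard_eq_of_natCard_ptsOfPeriod_eq [Finite X] [Finite Y] {σ : Equiv.Perm X}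
    {τ : Equiv.Perm Y}
    (h : ∀ m, 0 < m → Nat.card (ptsOfPeriod σ m) = Nat.card (ptsOfPeriod τ m)) :
    Nat.card X = Nat.card Y := by
  have hcard := h (orderOf σ * orderOf τ) (Nat.mul_pos (orderOf_pos σ) (orderOf_pos τ))
  rwa [ptsOfPeriod_eq_univ_of_orderOf_dvd (dvd_mul_right _ _),
    ptsOfPeriod_eq_univ_of_orderOf_dvd (dvd_mul_left _ _), Nat.card_coe_set_eq,
    Nat.card_coe_set_eq, Set.ncard_univ, Set.ncard_univ] at hcard

end Perm

theorem exists_semiconj_of_natCard_ptsOfPeriod_eq [Finite X] [Finite Y] {f : X → X} {g : Y → Y}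
    (hf : Bijective f) (hg : Bijective g)
    (h : ∀ m, 0 < m → Nat.card (ptsOfPeriod f m) = Nat.card (ptsOfPeriod g m)) :
    ∃ e : X ≃ Y, Semiconj e f g := by
  let σ : Equiv.Perm X := Equiv.ofBijective f hf
  let τ : Equiv.Perm Y := Equiv.ofBijective g hg
  obtain ⟨a⟩ : Nonempty (X ≃ Y) :=
    Finite.card_eq.1 (natCard_eq_of_natCard_ptsOfPeriod_eq (σ := σ) (τ := τ) h)
  have ha : Semiconj a σ (a.permCongr σ) := fun x => by simp
  have hconj : IsConj (a.permCongr σ) τ :=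
    isConj_of_natCard_ptsOfPeriod_eq fun m hm =>
      (natCard_ptsOfPeriod_eq_of_semiconj ha m).symm.trans (h m hm)
  obtain ⟨c, hc⟩ := isConj_iff.1 hconj
  have hc' : Semiconj c (a.permCongr σ) τ := fun y => by simp [← hc]
  exact ⟨a.trans c, hc'.comp_left ha⟩

end PeriodicPoints

section Blocks

theorem finrank_ker_mulLeft {F A : Type*} [Field F] [CommRing A] [Algebra F A] [Module.Finite F A]
    (a : A) : Module.finrank F (LinearMap.ker (LinearMap.mulLeft F a)) =
      Module.finrank F (A ⧸ Ideal.span {a}) := by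
  have hrange : LinearMap.range (LinearMap.mulLeft F a) = (Ideal.span {a}).restrictScalars F := by
    ext v
    simp [Ideal.mem_span_singleton, dvd_def, eq_comm]
  have hker := (LinearMap.mulLeft F a).finrank_range_add_finrank_ker
  have hcoker := Submodule.finrank_quotient_add_finrank (LinearMap.range (LinearMap.mulLeft F a))
  rw [hrange] at hker hcoker
  have : Module.finrank F (A ⧸ (Ideal.span {a}).restrictScalars F) =
    Module.finrank F (A ⧸ Ideal.span {a}) := rfl
  omega

theorem finrank_quotient_span_quotientMk {F : Type*} [Field F] {g f d : F[X]}
    (hd : Ideal.span {g} ⊔ Ideal.span {f} = Ideal.span {d}) :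
    Module.finrank F ((F[X] ⧸ Ideal.span {g}) ⧸ Ideal.span {Ideal.Quotient.mk (Ideal.span {g}) f}) =
      d.natDegree := by
  have hmap : Ideal.span {Ideal.Quotient.mk (Ideal.span {g}) f} =
      (Ideal.span {f}).map (Ideal.Quotient.mkₐ F (Ideal.span {g})) := by
    rw [Ideal.map_span, Set.image_singleton, Ideal.Quotient.mkₐ_eq_mk]
  rw [← finrank_quotient_span_eq_natDegree (f := d)]
  exact (((Ideal.quotientEquivAlgOfEq F hmap).trans (DoubleQuot.quotQuotEquivQuotSupₐ F _ _)).trans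
    (Ideal.quotientEquivAlgOfEq F hd)).toLinearEquiv.finrank_eq

theorem finrank_ker_mulLeft_mk {F : Type*} [Field F] {g f d : F[X]} (hg : g ≠ 0)
    (hd : Ideal.span {g} ⊔ Ideal.span {f} = Ideal.span {d}) :
    Module.finrank F (LinearMap.ker (LinearMap.mulLeft F (AdjoinRoot.mk g f))) = d.natDegree := by
  have : Module.Finite F (AdjoinRoot g) := (AdjoinRoot.powerBasis hg).finite
  exact (finrank_ker_mulLeft _).trans (finrank_quotient_span_quotientMk hd)

theorem span_pow_sup_span_pow_mul {R : Type*} [CommRing R] {p u : R} (hu : IsCoprime p u)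
    (k w : ℕ) : Ideal.span {p ^ k} ⊔ Ideal.span {p ^ w * u} = Ideal.span {p ^ min k w} := by
  have hcop : Ideal.span {p ^ k} ⊔ Ideal.span {u} = ⊤ :=
    Ideal.isCoprime_iff_sup_eq.1 ((Ideal.isCoprime_span_singleton_iff _ _).2 hu.pow_left)
  rw [← Ideal.span_singleton_mul_span_singleton, Ideal.sup_mul_eq_of_coprime_right hcop]
  rcases le_total k w with h | h
  · rw [min_eq_left h, sup_eq_left, Ideal.span_singleton_le_span_singleton]
    exact pow_dvd_pow p h
  · rw [min_eq_right h, sup_eq_right, Ideal.span_singleton_le_span_singleton]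
    exact pow_dvd_pow p h

theorem finite_adjoinRoot {F : Type*} [Field F] [Finite F] {g : F[X]} (hg : g ≠ 0) :
    Finite (AdjoinRoot g) :=
  have : Module.Finite F (AdjoinRoot g) := (AdjoinRoot.powerBasis hg).finite
  Module.finite_of_finite F

theorem dvd_X_pow_sub_one_iff {R : Type*} [CommRing R] {p : R[X]} {m : ℕ} :
    p ∣ X ^ m - 1 ↔ orderOf (AdjoinRoot.root p) ∣ m := by
  rw [orderOf_dvd_iff_pow_eq_one, ← AdjoinRoot.mk_eq_zero, map_sub, map_pow, map_one,
    AdjoinRoot.mk_X, sub_eq_zero]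

theorem not_sq_dvd_X_pow_sub_one {F : Type*} [Field F] (c : ℕ) [CharP F c] {p : F[X]}
    (hp : Irreducible p) {m : ℕ} (hm : ¬c ∣ m) : ¬p * p ∣ X ^ m - 1 := fun h => by
  have hsep := separable_X_pow_sub_C' c m (1 : F) hm one_ne_zero
  rw [map_one] at hsep
  exact hp.not_isUnit (hsep.squarefree p h)

theorem exists_X_pow_sub_one_eq {F : Type*} [Field F] (c : ℕ) [Fact c.Prime] [CharP F c]
    {p : F[X]} (hp : Irreducible p) {m : ℕ} (hm : m ≠ 0) :
    ∃ u : F[X], IsCoprime p u ∧ (X ^ m - 1 : F[X]) =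
      p ^ (if orderOf (AdjoinRoot.root p) ∣ m then ordProj[c] m else 0) * u := by
  split_ifs with h
  · have hfact : (X ^ m - 1 : F[X]) = (X ^ ordCompl[c] m - 1) ^ ordProj[c] m := by
      rw [sub_pow_char_pow, ← pow_mul, one_pow, mul_comm, Nat.ordProj_mul_ordCompl_eq_self]
    obtain ⟨u, hu⟩ : p ∣ X ^ ordCompl[c] m - 1 :=
      hp.prime.dvd_of_dvd_pow (hfact ▸ dvd_X_pow_sub_one_iff.2 h)
    refine ⟨u ^ ordProj[c] m, IsCoprime.pow_right ?_, by rw [hfact, hu, mul_pow]⟩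
    rw [hp.coprime_iff_not_dvd]
    intro hpu
    exact not_sq_dvd_X_pow_sub_one c hp (Nat.not_dvd_ordCompl Fact.out hm)
      (hu ▸ mul_dvd_mul_left p hpu)
  · exact ⟨X ^ m - 1, by rwa [hp.coprime_iff_not_dvd, dvd_X_pow_sub_one_iff],
      by rw [pow_zero, one_mul]⟩

/-- Multiplication by the class of `X` on `F[X] / (g)`. For `g` a power of an irreducible
polynomial these maps are the blocks of the primary decomposition of a linear map. -/
noncomputable def mulRoot {F : Type*} [Field F] (g : F[X]) : AdjoinRoot g →ₗ[F] AdjoinRoot g :=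
  LinearMap.mulLeft F (AdjoinRoot.root g)

theorem mem_ptsOfPeriod_mulRoot {F : Type*} [Field F] {g : F[X]} {m : ℕ} {v : AdjoinRoot g} :
    v ∈ ptsOfPeriod (mulRoot g) m ↔
      v ∈ LinearMap.ker (LinearMap.mulLeft F (AdjoinRoot.mk g (X ^ m - 1))) := by
  have hiter : (mulRoot g)^[m] v = AdjoinRoot.root g ^ m * v := mul_left_iterate_apply _ _
  rw [mem_ptsOfPeriod, IsPeriodicPt, IsFixedPt, hiter, LinearMap.mem_ker, LinearMap.mulLeft_apply,
    map_sub, map_pow, map_one, AdjoinRoot.mk_X, sub_mul, one_mul, sub_eq_zero]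

theorem natCard_ptsOfPeriod_mulRoot_pow {F : Type*} [Field F] [Finite F] (c : ℕ) [Fact c.Prime]
    [CharP F c] {p : F[X]} (hp : Irreducible p) (k : ℕ) {m : ℕ} (hm : m ≠ 0) :
    Nat.card (ptsOfPeriod (mulRoot (p ^ k)) m) = Nat.card F ^
      (min k (if orderOf (AdjoinRoot.root p) ∣ m then ordProj[c] m else 0) * p.natDegree) := by
  have := finite_adjoinRoot (pow_ne_zero k hp.ne_zero)
  obtain ⟨u, hu, hfact⟩ := exists_X_pow_sub_one_eq c hp hm
  rw [Nat.card_congr (Equiv.subtypeEquivRight fun v => mem_ptsOfPeriod_mulRoot),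
    Module.natCard_eq_pow_finrank (K := F), ← natDegree_pow,
    finrank_ker_mulLeft_mk (pow_ne_zero k hp.ne_zero) (hfact ▸ span_pow_sup_span_pow_mul hu k _)]

section FiniteField

variable {F : Type*} [Field F] [Finite F] {p p' : F[X]}

theorem orderOf_root_eq_zero_iff (hp : Irreducible p) :
    orderOf (AdjoinRoot.root p) = 0 ↔ Associated p X := by
  have : Fact (Irreducible p) := ⟨hp⟩
  have := finite_adjoinRoot hp.ne_zero
  rw [← hp.dvd_irreducible_iff_associated irreducible_X, ← AdjoinRoot.mk_eq_zero, AdjoinRoot.mk_X]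
  refine ⟨fun h => ?_, fun h => by rw [h, orderOf_zero]⟩
  by_contra hne
  have hpos := orderOf_pos (Units.mk0 _ hne)
  rw [← orderOf_units, Units.val_mk0, h] at hpos
  exact hpos.false

theorem natDegree_eq_one_of_orderOf_root_eq_zero (hp : Irreducible p)
    (h0 : orderOf (AdjoinRoot.root p) = 0) : p.natDegree = 1 := by
  rw [natDegree_eq_of_degree_eq
    (degree_eq_degree_of_associated ((orderOf_root_eq_zero_iff hp).1 h0)), natDegree_X]

theorem orderOf_root_dvd (hp : Irreducible p) (h0 : orderOf (AdjoinRoot.root p) ≠ 0) :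
    orderOf (AdjoinRoot.root p) ∣ Nat.card F ^ p.natDegree - 1 := by
  have : Fact (Irreducible p) := ⟨hp⟩
  have := finite_adjoinRoot hp.ne_zero
  have := Fintype.ofFinite (AdjoinRoot p)
  have hcard : Fintype.card (AdjoinRoot p) = Nat.card F ^ p.natDegree := by
    rw [← Nat.card_eq_fintype_card, Module.natCard_eq_pow_finrank (K := F)]
    exact congrArg _ finrank_quotient_span_eq_natDegree
  rw [orderOf_dvd_iff_pow_eq_one, ← hcard]
  exact FiniteField.pow_card_sub_one_eq_one _ fun h => h0 (by rw [h, orderOf_zero])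

theorem dvd_cyclotomic_orderOf_root {K : Type*} [Field K] {r : K[X]} (hr : Irreducible r)
    (h0 : orderOf (AdjoinRoot.root r) ≠ 0) :
    r ∣ cyclotomic (orderOf (AdjoinRoot.root r)) K := by
  have : Fact (Irreducible r) := ⟨hr⟩
  have hroot := (IsPrimitiveRoot.orderOf (AdjoinRoot.root r)).isRoot_cyclotomic
    (Nat.pos_of_ne_zero h0)
  rw [← map_cyclotomic _ (AdjoinRoot.of r), IsRoot.def, eval_map] at hroot
  rwa [← AdjoinRoot.mk_eq_zero, ← AdjoinRoot.aeval_eq]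

theorem coprime_natCard_orderOf_root (hp : Irreducible p)
    (h0 : orderOf (AdjoinRoot.root p) ≠ 0) :
    (Nat.card F).Coprime (orderOf (AdjoinRoot.root p)) := by
  have hpow : 1 ≤ Nat.card F ^ p.natDegree := Nat.one_le_pow _ _ Nat.card_pos
  refine ((Nat.coprime_pow_left_iff hp.natDegree_pos _ _).1 ?_).coprime_dvd_right
    (orderOf_root_dvd hp h0)
  exact (Nat.coprime_self_sub_right hpow).2 (Nat.coprime_one_right _)

theorem natDegree_eq_orderOf_natCard (hp : Irreducible p)
    (h0 : orderOf (AdjoinRoot.root p) ≠ 0) :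
    p.natDegree = orderOf (Nat.card F : ZMod (orderOf (AdjoinRoot.root p))) := by
  have := Fintype.ofFinite F
  obtain ⟨c, hc⟩ := CharP.exists F
  obtain ⟨n, hcp, hn⟩ := FiniteField.card F c
  have := Fact.mk hcp
  have hcop := coprime_natCard_orderOf_root hp h0
  rw [Nat.card_eq_fintype_card, hn] at hcop
  rw [natDegree_of_dvd_cyclotomic_of_irreducible hn
    ((Nat.coprime_pow_left_iff n.pos _ _).1 hcop) (dvd_cyclotomic_orderOf_root hp h0) hp,
    ← orderOf_units, ZMod.coe_unitOfCoprime, Nat.card_eq_fintype_card, hn]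

theorem natDegree_eq_of_orderOf_root_eq (hp : Irreducible p) (hp' : Irreducible p')
    (h : orderOf (AdjoinRoot.root p) = orderOf (AdjoinRoot.root p')) :
    p.natDegree = p'.natDegree := by
  by_cases h0 : orderOf (AdjoinRoot.root p) = 0
  · rw [natDegree_eq_one_of_orderOf_root_eq_zero hp h0,
      natDegree_eq_one_of_orderOf_root_eq_zero hp' (h ▸ h0)]
  · rw [natDegree_eq_orderOf_natCard hp h0, natDegree_eq_orderOf_natCard hp' (h ▸ h0), h]

theorem mulRoot_pow_bijective (hp : Irreducible p) (h0 : orderOf (AdjoinRoot.root p) ≠ 0)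
    (k : ℕ) : Bijective (mulRoot (p ^ k)) := by
  have hpk := pow_ne_zero k hp.ne_zero
  have := finite_adjoinRoot hpk
  have hcop : IsCoprime (p ^ k) X := IsCoprime.pow_left <| by
    rwa [hp.coprime_iff_not_dvd, hp.dvd_irreducible_iff_associated irreducible_X,
      ← orderOf_root_eq_zero_iff hp]
  refine Injective.bijective_of_finite ((injective_iff_map_eq_zero _).2 fun v hv => ?_)
  obtain ⟨f, rfl⟩ := AdjoinRoot.mk_surjective v
  rw [mulRoot, LinearMap.mulLeft_apply, ← AdjoinRoot.mk_X, ← map_mul, AdjoinRoot.mk_eq_zero] at hv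
  exact AdjoinRoot.mk_eq_zero.2 (hcop.dvd_of_dvd_mul_left hv)

theorem exists_semiconj_mulRoot_of_associated {K : Type*} [Field K] {g g' : K[X]}
    (h : Associated g g') :
    ∃ e : AdjoinRoot g ≃ AdjoinRoot g', Semiconj e (mulRoot g) (mulRoot g') := by
  let e := Ideal.quotEquivOfEq (Ideal.span_singleton_eq_span_singleton.2 h)
  exact ⟨e.toEquiv, map_mul e (AdjoinRoot.root g)⟩

theorem exists_semiconj_mulRoot_pow (hp : Irreducible p) (hp' : Irreducible p') {k k' : ℕ}
    (hdim : k * p.natDegree = k' * p'.natDegree)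
    (horder : orderOf (AdjoinRoot.root p) = orderOf (AdjoinRoot.root p')) :
    ∃ e : AdjoinRoot (p ^ k) ≃ AdjoinRoot (p' ^ k'),
      Semiconj e (mulRoot (p ^ k)) (mulRoot (p' ^ k')) := by
  have hdeg := natDegree_eq_of_orderOf_root_eq hp hp' horder
  obtain rfl : k = k' := Nat.eq_of_mul_eq_mul_right hp.natDegree_pos (hdim.trans (by rw [hdeg]))
  by_cases h0 : orderOf (AdjoinRoot.root p) = 0
  · exact exists_semiconj_mulRoot_of_associated <| Associated.pow_pow <|
      ((orderOf_root_eq_zero_iff hp).1 h0).trans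
        ((orderOf_root_eq_zero_iff hp').1 (horder ▸ h0)).symm
  · obtain ⟨c, hc⟩ := CharP.exists F
    have : Fact c.Prime := ⟨CharP.char_is_prime F c⟩
    have := finite_adjoinRoot (pow_ne_zero k hp.ne_zero)
    have := finite_adjoinRoot (pow_ne_zero k hp'.ne_zero)
    refine exists_semiconj_of_natCard_ptsOfPeriod_eq (mulRoot_pow_bijective hp h0 k)
      (mulRoot_pow_bijective hp' (horder ▸ h0) k) fun m hm => ?_
    rw [natCard_ptsOfPeriod_mulRoot_pow c hp k hm.ne',
      natCard_ptsOfPeriod_mulRoot_pow c hp' k hm.ne', horder, hdeg]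

end FiniteField

end Blocks

theorem functionalGraph_isIsomorphic_iff {V W : Type*} {f : V → V} {g : W → W} :
    (functionalGraph f).IsIsomorphic (functionalGraph g) ↔ ∃ e : V ≃ W, Semiconj e f g := by
  constructor
  · rintro ⟨e⟩
    exact ⟨e.toEquiv, fun v => ((e.map_rel_iff (a := v) (b := f v)).2 rfl).symm⟩
  · rintro ⟨e, he⟩
    refine ⟨⟨e, fun {a b} => ?_⟩⟩
    change g (e a) = e b ↔ f a = b
    rw [← he a, e.apply_eq_iff_eq]

theorem exists_semiconj_pi {ι κ : Type*} {A : ι → Type*} {B : κ → Type*}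
    {f : ∀ i, A i → A i} {g : ∀ j, B j → B j} (E : ι ≃ κ)
    (h : ∀ i, ∃ e : A i ≃ B (E i), Semiconj e (f i) (g (E i))) :
    ∃ e : (∀ i, A i) ≃ (∀ j, B j), Semiconj e (Pi.map f) (Pi.map g) := by
  choose e he using h
  refine ⟨Equiv.piCongr E e, fun v => funext fun j => ?_⟩
  obtain ⟨i, rfl⟩ := E.surjective j
  rw [Pi.map_apply, Equiv.piCongr_apply_apply, Equiv.piCongr_apply_apply]
  exact he i (v i)

section PrimaryDecomposition

universe u

theorem exists_linearEquiv_pi_subtype {R ι : Type*} [Semiring R] {A : ι → Type*}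
    [∀ i, AddCommMonoid (A i)] [∀ i, Module R (A i)] {P : ι → Prop}
    (h : ∀ i, ¬P i → Subsingleton (A i)) :
    ∃ e : (∀ i, A i) ≃ₗ[R] ∀ i : {i // P i}, A i, ∀ v i, e v i = v i := by
  classical
  refine ⟨LinearEquiv.ofBijective (LinearMap.pi fun i => LinearMap.proj i.1) ⟨fun v w hvw => ?_,
    fun w => ⟨fun i => if hi : P i then w ⟨i, hi⟩ else 0, ?_⟩⟩, fun _ _ => rfl⟩
  · funext i
    by_cases hi : P i
    · exact congrFun hvw ⟨i, hi⟩
    · exact (h i hi).elim _ _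
  · funext i
    exact dif_pos i.2

theorem subsingleton_adjoinRoot_pow_zero {R : Type*} [CommRing R] (p : R[X]) :
    Subsingleton (AdjoinRoot (p ^ 0)) :=
  Ideal.Quotient.subsingleton_iff.2 (by rw [pow_zero, Ideal.span_singleton_one])

/-- A decomposition of the linear map `T` into blocks: an identification of `T` with the product
of the maps "multiplication by `X`" on `F[X] / (p i ^ k i)`, with `p i` irreducible and `0 < k i`.
Only its existence and the types of its blocks matter here, not its uniqueness. -/
structure PrimaryDecomposition {F : Type u} [Field F] {V : Type*} [AddCommGroup V] [Module F V]
    (T : V →ₗ[F] V) where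
  ι : Type u
  [fintype : Fintype ι]
  poly : ι → F[X]
  irreducible : ∀ i, Irreducible (poly i)
  exponent : ι → ℕ
  exponent_pos : ∀ i, 0 < exponent i
  equiv : V ≃ₗ[F] ∀ i, AdjoinRoot (poly i ^ exponent i)
  semiconj : Semiconj equiv T (Pi.map fun i => mulRoot (poly i ^ exponent i))

namespace PrimaryDecomposition

attribute [instance] PrimaryDecomposition.fintype

section Field

variable {F : Type u} [Field F] {V : Type*} [AddCommGroup V] [Module F V] {S : V →ₗ[F] V}

theorem nonempty [Module.Finite F V] (T : V →ₗ[F] V) : Nonempty (PrimaryDecomposition T) := by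
  classical
  obtain ⟨ι, _, p, hp, k, ⟨φ⟩⟩ := Module.equiv_directSum_of_isTorsion
    (Module.AEval.isTorsion_of_finiteDimensional F V T)
  let e₀ : V ≃ₗ[F] ∀ i, AdjoinRoot (p i ^ k i) :=
    (Module.AEval'.of T).trans ((φ.restrictScalars F).trans
      (DirectSum.linearEquivFunOnFintype F ι fun i => F[X] ⧸ Ideal.span {p i ^ k i}))
  have he₀ : ∀ v i, e₀ (T v) i = mulRoot (p i ^ k i) (e₀ v i) := fun v i => by
    change (φ (Module.AEval'.of T (T v))) i = _
    rw [← Module.AEval'.X_smul_of, map_smul]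
    rfl
  obtain ⟨r, hr⟩ := exists_linearEquiv_pi_subtype (R := F)
    (A := fun i => AdjoinRoot (p i ^ k i)) (P := fun i => 0 < k i) fun i hi => by
      rw [Nat.eq_zero_of_not_pos hi]
      exact subsingleton_adjoinRoot_pow_zero (p i)
  exact ⟨{
    ι := {i // 0 < k i}
    poly := fun i => p i
    irreducible := fun i => hp i
    exponent := fun i => k i
    exponent_pos := fun i => i.2
    equiv := e₀.trans r
    semiconj := fun v => funext fun i =>
      (hr _ i).trans ((he₀ v i).trans (congrArg _ (hr _ i).symm)) }⟩

/-- The dimension of a block. -/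
noncomputable def dim (D : PrimaryDecomposition S) (i : D.ι) : ℕ :=
  D.exponent i * (D.poly i).natDegree

/-- The order of the roots of the irreducible polynomial of a block, with the value `0` on the
nilpotent blocks, where that polynomial is `X`. -/
noncomputable def order (D : PrimaryDecomposition S) (i : D.ι) : ℕ :=
  orderOf (AdjoinRoot.root (D.poly i))

/-- The number of blocks of dimension `d` and order `o`. -/
noncomputable def blockCount (D : PrimaryDecomposition S) (d o : ℕ) : ℕ :=
  Nat.card {i // (D.dim i, D.order i) = (d, o)}

theorem blockCount_ne_zero {D : PrimaryDecomposition S} {d o : ℕ} (h : D.blockCount d o ≠ 0) :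
    ∃ i, D.dim i = d ∧ D.order i = o := by
  obtain ⟨⟨i, hi⟩⟩ := (Nat.card_ne_zero.1 h).1
  exact ⟨i, Prod.mk.inj hi⟩

variable (D : PrimaryDecomposition S)

theorem dim_pos (i : D.ι) : 0 < D.dim i :=
  Nat.mul_pos (D.exponent_pos i) (D.irreducible i).natDegree_pos

theorem sum_dim : ∑ i, D.dim i = Module.finrank F V := by
  have hne : ∀ i, D.poly i ^ D.exponent i ≠ 0 := fun i => pow_ne_zero _ (D.irreducible i).ne_zero
  have : ∀ i, Module.Finite F (AdjoinRoot (D.poly i ^ D.exponent i)) := fun i =>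
    (AdjoinRoot.powerBasis (hne i)).finite
  rw [D.equiv.finrank_eq, Module.finrank_pi_fintype]
  refine Finset.sum_congr rfl fun i _ => ?_
  rw [dim, ← natDegree_pow]
  exact finrank_quotient_span_eq_natDegree.symm

theorem dim_le (i : D.ι) : D.dim i ≤ Module.finrank F V :=
  D.sum_dim ▸ Finset.single_le_sum (fun _ _ => Nat.zero_le _) (Finset.mem_univ i)

end Field

section FiniteField

variable {F : Type u} [Field F] [Finite F] {V W : Type*} [AddCommGroup V] [Module F V]
  [AddCommGroup W] [Module F W] {S : V →ₗ[F] V} {T : W →ₗ[F] W}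

theorem order_mem (D : PrimaryDecomposition S) (i : D.ι) :
    D.order i ∈ insert 0 (Nat.card F ^ D.dim i - 1).divisors := by
  rw [Finset.mem_insert, Nat.mem_divisors]
  refine or_iff_not_imp_left.2 fun h0 => ⟨?_, ?_⟩
  · exact (orderOf_root_dvd (D.irreducible i) h0).trans
      (Nat.pow_sub_one_dvd_pow_sub_one _ (Dvd.intro_left _ rfl))
  · exact (Nat.sub_pos_of_lt (Nat.one_lt_pow (D.dim_pos i).ne' Finite.one_lt_card)).ne'

theorem natCard_dim_eq (D : PrimaryDecomposition S) (d : ℕ) :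
    Nat.card {i // D.dim i = d} =
      D.blockCount d 0 + ∑ o ∈ (Nat.card F ^ d - 1).divisors, D.blockCount d o := by
  classical
  have hmem : ∀ i ∈ ({i | D.dim i = d} : Finset D.ι),
      D.order i ∈ insert 0 (Nat.card F ^ d - 1).divisors := fun i hi =>
    (Finset.mem_filter.1 hi).2 ▸ D.order_mem i
  rw [← Finset.sum_insert (f := D.blockCount d) (by simp), Nat.subtype_card {i | D.dim i = d}
    (by simp), Finset.card_eq_sum_card_fiberwise hmem]
  exact Finset.sum_congr rfl fun o _ => (Nat.subtype_card _ (by simp)).symm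

theorem exists_semiconj_of_blockCount_eq (D : PrimaryDecomposition S)
    (D' : PrimaryDecomposition T) (h : ∀ d o, D.blockCount d o = D'.blockCount d o) :
    ∃ e : V ≃ W, Semiconj e S T := by
  have hfiber : ∀ b : ℕ × ℕ,
      Nonempty ({i // (D.dim i, D.order i) = b} ≃ {j // (D'.dim j, D'.order j) = b}) :=
    fun b => Finite.card_eq.1 (h b.1 b.2)
  let E : D.ι ≃ D'.ι := Equiv.ofFiberEquiv fun b => (hfiber b).some
  have hE : ∀ i, (D'.dim (E i), D'.order (E i)) = (D.dim i, D.order i) :=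
    Equiv.ofFiberEquiv_map fun b => (hfiber b).some
  obtain ⟨a, ha⟩ := exists_semiconj_pi
    (f := fun i => mulRoot (D.poly i ^ D.exponent i))
    (g := fun j => mulRoot (D'.poly j ^ D'.exponent j)) E fun i =>
    exists_semiconj_mulRoot_pow (D.irreducible i) (D'.irreducible (E i))
      (congrArg Prod.fst (hE i)).symm (congrArg Prod.snd (hE i)).symm
  have hsymm : Semiconj D'.equiv.symm _ T :=
    D'.semiconj.inverse_left D'.equiv.symm_apply_apply D'.equiv.apply_symm_apply
  exact ⟨(D.equiv.toEquiv.trans a).trans D'.equiv.symm.toEquiv,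
    hsymm.comp_left (ha.comp_left D.semiconj)⟩

end FiniteField

end PrimaryDecomposition

end PrimaryDecomposition

section Counting

theorem natCard_quotient_le {α β : Type*} {s : Setoid α} {t : Finset β} {f : α → β}
    (hf : ∀ a, f a ∈ t) (h : ∀ a b, f a = f b → s a b) : Nat.card (Quotient s) ≤ t.card := by
  have hinj : Injective fun c : Quotient s => (⟨f c.out, hf c.out⟩ : t) := fun c c' hcc' => by
    rw [← c.out_eq, ← c'.out_eq]
    exact Quotient.sound (h _ _ (congrArg Subtype.val hcc'))
  simpa only [Nat.card_eq_card_toFinset, Nat.card_eq_fintype_card, Fintype.card_coe] using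
    Nat.card_le_card_of_injective _ hinj

theorem card_le_natCard_quotient {α β : Type*} {s : Setoid α} [Finite (Quotient s)] {t : Finset β}
    {f : β → α} (h : ∀ b ∈ t, ∀ b' ∈ t, s (f b) (f b') → b = b') :
    t.card ≤ Nat.card (Quotient s) := by
  have hinj : Injective fun b : t => (⟦f b⟧ : Quotient s) := fun b b' hbb' =>
    Subtype.ext (h b b.2 b' b'.2 (Quotient.exact hbb'))
  simpa only [Nat.card_eq_fintype_card, Fintype.card_coe] using
    Nat.card_le_card_of_injective _ hinj

theorem card_piAntidiag_nat_eq_choose {ι : Type*} [DecidableEq ι] (s : Finset ι) (m : ℕ) :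
    (s.piAntidiag m).card = (s.card + m - 1).choose m := by
  rw [← Finset.card_finsuppAntidiag_nat_eq_choose, Finset.finsuppAntidiag]
  simp

/-- The families of multisets, one of size `lam k` on `D k` for each `k`. A multiset is encoded
by its multiplicity function. -/
def multisetFamilies {κ ι : Type*} [Fintype κ] [DecidableEq κ] [DecidableEq ι] (D : κ → Finset ι)
    (lam : κ → ℕ) : Finset (κ → ι → ℕ) :=
  Fintype.piFinset fun k => (D k).piAntidiag (lam k)

theorem mem_multisetFamilies {κ ι : Type*} [Fintype κ] [DecidableEq κ] [DecidableEq ι]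
    {D : κ → Finset ι} {lam : κ → ℕ} {c : κ → ι → ℕ} : c ∈ multisetFamilies D lam ↔
      ∀ k, ∑ i ∈ D k, c k i = lam k ∧ ∀ i, c k i ≠ 0 → i ∈ D k := by
  simp only [multisetFamilies, Fintype.mem_piFinset, Finset.mem_piAntidiag]

theorem card_multisetFamilies {κ ι : Type*} [Fintype κ] [DecidableEq κ] [DecidableEq ι]
    (D : κ → Finset ι) (lam : κ → ℕ) :
    (multisetFamilies D lam).card = ∏ k, ((D k).card + lam k - 1).choose (lam k) := by
  simp only [multisetFamilies, Fintype.card_piFinset, card_piAntidiag_nat_eq_choose]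

/-- The weight `∑ i * a_i` of a vector `(a_1, …, a_n)`, indexed from `0` as in
`boundedWeightVectors`. -/
def weight {n : ℕ} (a : Fin n → ℕ) : ℕ := ∑ k : Fin n, a k * ((k : ℕ) + 1)

theorem le_weight {n : ℕ} (a : Fin n → ℕ) (k : Fin n) : a k ≤ weight a :=
  (Nat.le_mul_of_pos_right _ (Nat.succ_pos _)).trans
    (Finset.single_le_sum (f := fun k : Fin n => a k * ((k : ℕ) + 1)) (fun _ _ => Nat.zero_le _)
      (Finset.mem_univ k))

/-- The vectors of weight `m`. They encode the partitions of `m` into parts of size at most `n`: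
the entry `a k` is the multiplicity of the part `k + 1`. -/
def weightVectors (n m : ℕ) : Finset (Fin n → ℕ) :=
  {a ∈ Fintype.piFinset fun _ : Fin n => Finset.range (m + 1) | weight a = m}

theorem mem_weightVectors {n m : ℕ} {a : Fin n → ℕ} : a ∈ weightVectors n m ↔ weight a = m := by
  rw [weightVectors, Finset.mem_filter, and_iff_right_iff_imp]
  rintro rfl
  exact Fintype.mem_piFinset.2 fun k => Finset.mem_range.2 (Nat.lt_succ_of_le (le_weight a k))

theorem mem_insert_zero_boundedWeightVectors {n : ℕ} {lam : Fin n → ℕ} :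
    lam ∈ insert 0 (boundedWeightVectors n) ↔ weight lam ≤ n := by
  rw [Finset.mem_insert, mem_boundedWeightVectors]
  by_cases h0 : lam = 0
  · simp [h0, weight]
  · simp [h0, weight]

theorem weight_natCard_fiber {ι : Type*} [Fintype ι] {n : ℕ} {w : ι → ℕ} (hpos : ∀ i, 0 < w i)
    (hle : ∀ i, w i ≤ n) :
    weight (fun k : Fin n => Nat.card {i // w i = (k : ℕ) + 1}) = ∑ i, w i := by
  let index : ι → Fin n := fun i => ⟨w i - 1, by have := hpos i; have := hle i; omega⟩
  have hindex : ∀ i k, index i = k ↔ w i = (k : ℕ) + 1 := fun i k => by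
    have := hpos i
    simp only [index, Fin.ext_iff]
    omega
  rw [weight, ← Finset.sum_fiberwise Finset.univ index]
  refine Finset.sum_congr rfl fun k _ => ?_
  rw [Nat.subtype_card {i | index i = k} (by simp [hindex])]
  exact (Finset.sum_const_nat fun i hi => (hindex i k).1 (Finset.mem_filter.1 hi).2).symm

end Counting

namespace PrimaryDecomposition

variable {F : Type*} [Field F] {V : Type*} [AddCommGroup V] [Module F V] {T : V →ₗ[F] V}

/-- The numbers of nilpotent blocks of dimensions `1, …, n`. -/
noncomputable def nilpotentType (D : PrimaryDecomposition T) (n : ℕ) : Fin n → ℕ :=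
  fun k => D.blockCount (k + 1) 0

/-- The numbers of invertible blocks of dimensions `1, …, n`, listed by order. -/
noncomputable def unitType (D : PrimaryDecomposition T) (n : ℕ) : Fin n → ℕ → ℕ :=
  fun k o => if o = 0 then 0 else D.blockCount (k + 1) o

/-- The numbers of invertible blocks of dimensions `1, …, n`. -/
noncomputable def unitCount (D : PrimaryDecomposition T) (n : ℕ) : Fin n → ℕ :=
  fun k => ∑ o ∈ (Nat.card F ^ ((k : ℕ) + 1) - 1).divisors, D.blockCount (k + 1) o

theorem weight_nilpotentType_add_weight_unitCount [Finite F] (D : PrimaryDecomposition T) {n : ℕ}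
    (hn : Module.finrank F V = n) : weight (D.nilpotentType n) + weight (D.unitCount n) = n := by
  subst hn
  conv_rhs => rw [← D.sum_dim, ← weight_natCard_fiber D.dim_pos D.dim_le]
  simp only [weight, nilpotentType, unitCount, natCard_dim_eq, add_mul, Finset.sum_add_distrib]

theorem unitType_mem_multisetFamilies [Finite F] (D : PrimaryDecomposition T) (n : ℕ) :
    D.unitType n ∈ multisetFamilies
      (fun k : Fin n => (Nat.card F ^ ((k : ℕ) + 1) - 1).divisors) (D.unitCount n) := by
  refine mem_multisetFamilies.2 fun k =>
    ⟨Finset.sum_congr rfl fun o ho => if_neg (Nat.pos_of_mem_divisors ho).ne', fun o ho => ?_⟩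
  obtain ⟨h0, hcount⟩ := ite_ne_left_iff.1 ho
  obtain ⟨i, hdim, rfl⟩ := blockCount_ne_zero (Ne.symm hcount)
  have hmem := D.order_mem i
  rw [hdim] at hmem
  exact (Finset.mem_insert.1 hmem).resolve_left h0

theorem blockCount_eq_zero (D : PrimaryDecomposition T) {d : ℕ}
    (hd : ¬(0 < d ∧ d ≤ Module.finrank F V)) (o : ℕ) : D.blockCount d o = 0 := by
  by_contra hne
  obtain ⟨i, rfl, -⟩ := blockCount_ne_zero hne
  exact hd ⟨D.dim_pos i, D.dim_le i⟩

theorem exists_semiconj_of_types_eq [Finite F] {S T : V →ₗ[F] V} (D : PrimaryDecomposition S)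
    (D' : PrimaryDecomposition T) {n : ℕ} (hn : Module.finrank F V = n)
    (hnil : D.nilpotentType n = D'.nilpotentType n) (hunit : D.unitType n = D'.unitType n) :
    ∃ e : V ≃ V, Semiconj e S T := by
  refine exists_semiconj_of_blockCount_eq D D' fun d o => ?_
  by_cases hd : 0 < d ∧ d ≤ Module.finrank F V
  · obtain ⟨k, rfl⟩ : ∃ k : Fin n, d = k + 1 := ⟨⟨d - 1, by omega⟩, by grind⟩
    by_cases h0 : o = 0
    · exact h0 ▸ congrFun hnil k
    · simpa only [unitType, if_neg h0] using congrFun (congrFun hunit k) o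
  · rw [D.blockCount_eq_zero hd, D'.blockCount_eq_zero hd]

end PrimaryDecomposition

theorem numFunctionalGraphs_le (F : Type*) [Field F] [Finite F] (n : ℕ) :
    numFunctionalGraphs F n ≤ ∑ lam ∈ insert 0 (boundedWeightVectors n),
      (weightVectors n (n - weight lam)).card *
        ∏ k : Fin n, (numDivisors (Nat.card F) ((k : ℕ) + 1) + lam k - 1).choose (lam k) := by
  let D : ∀ T : (Fin n → F) →ₗ[F] (Fin n → F), PrimaryDecomposition T := fun T =>
    (PrimaryDecomposition.nonempty T).some
  let types : Finset (Σ _ : Fin n → ℕ, (Fin n → ℕ) × (Fin n → ℕ → ℕ)) :=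
    (insert 0 (boundedWeightVectors n)).sigma fun lam =>
      weightVectors n (n - weight lam) ×ˢ
        multisetFamilies (fun k : Fin n => (Nat.card F ^ ((k : ℕ) + 1) - 1).divisors) lam
  let type : ((Fin n → F) →ₗ[F] (Fin n → F)) → Σ _ : Fin n → ℕ, (Fin n → ℕ) × (Fin n → ℕ → ℕ) :=
    fun T => ⟨(D T).unitCount n, (D T).nilpotentType n, (D T).unitType n⟩
  have hmem : ∀ T, type T ∈ types := fun T => by
    have hweight := (D T).weight_nilpotentType_add_weight_unitCount (Module.finrank_fin_fun F)
    refine Finset.mem_sigma.2 ⟨mem_insert_zero_boundedWeightVectors.2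
      ((Nat.le_add_left _ _).trans_eq hweight), Finset.mem_product.2
      ⟨mem_weightVectors.2 ?_, (D T).unitType_mem_multisetFamilies n⟩⟩
    exact (Nat.sub_eq_of_eq_add hweight.symm).symm
  have hiso : ∀ S T, type S = type T →
      (functionalGraph S).IsIsomorphic (functionalGraph T) := fun S T h => by
    simp only [type, Sigma.mk.injEq, heq_eq_eq, Prod.mk.injEq] at h
    exact functionalGraph_isIsomorphic_iff.2
      ((D S).exists_semiconj_of_types_eq (D T) (Module.finrank_fin_fun F) h.2.1 h.2.2)
  refine (natCard_quotient_le hmem hiso).trans_eq ?_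
  simp only [types, Finset.card_sigma, Finset.card_product, card_multisetFamilies, numDivisors]

section SemisimpleMaps

theorem natCard_ptsOfPeriod_piMap {ι : Type*} [Fintype ι] {X : ι → Type*} (f : ∀ i, X i → X i)
    (m : ℕ) : Nat.card (ptsOfPeriod (Pi.map f) m) = ∏ i, Nat.card (ptsOfPeriod (f i) m) := by
  rw [← Nat.card_pi]
  refine Nat.card_congr ((Equiv.subtypeEquivRight fun x => ?_).trans
    (Equiv.subtypePiEquivPi (p := fun i x => x ∈ ptsOfPeriod (f i) m)))
  simp only [mem_ptsOfPeriod, IsPeriodicPt, IsFixedPt, Pi.map_iterate, funext_iff, Pi.map_apply]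

theorem natCard_ptsOfPeriod_prodMap {X Y : Type*} (f : X → X) (g : Y → Y) (m : ℕ) :
    Nat.card (ptsOfPeriod (Prod.map f g) m) =
      Nat.card (ptsOfPeriod f m) * Nat.card (ptsOfPeriod g m) := by
  have hprod : ptsOfPeriod (Prod.map f g) m = ptsOfPeriod f m ×ˢ ptsOfPeriod g m :=
    Set.ext fun x => isPeriodicPt_prodMap x
  rw [hprod]
  exact Set.ncard_prod

theorem natCard_ptsOfPeriod_zero {X : Type*} [Zero X] {m : ℕ} (hm : 0 < m) :
    Nat.card (ptsOfPeriod (0 : X → X) m) = 1 := by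
  obtain ⟨m, rfl⟩ := Nat.exists_eq_succ_of_ne_zero hm.ne'
  have hzero : ptsOfPeriod (0 : X → X) (m + 1) = {0} := Set.ext fun x => by
    rw [mem_ptsOfPeriod, IsPeriodicPt, IsFixedPt, iterate_succ_apply', Pi.zero_apply,
      Set.mem_singleton_iff, eq_comm]
  rw [hzero, Nat.card_unique]

theorem natCard_ptsOfPeriod_mul_left {M : Type*} [MonoidWithZero M] [IsRightCancelMulZero M]
    (a : M) (m : ℕ) :
    Nat.card (ptsOfPeriod (a * ·) m) = if orderOf a ∣ m then Nat.card M else 1 := by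
  have hmem : ∀ x, x ∈ ptsOfPeriod (a * ·) m ↔ a ^ m * x = x := fun x => by
    rw [mem_ptsOfPeriod, IsPeriodicPt, IsFixedPt, mul_left_iterate_apply]
  split_ifs with hdvd
  · have huniv : ptsOfPeriod (a * ·) m = Set.univ := Set.eq_univ_of_forall fun x => by
      rw [hmem, orderOf_dvd_iff_pow_eq_one.1 hdvd, one_mul]
    rw [huniv, Nat.card_univ]
  · have hzero : ptsOfPeriod (a * ·) m = {0} := Set.ext fun x => by
      rw [hmem, Set.mem_singleton_iff]
      refine ⟨fun h => by_contra fun hx => hdvd ?_, fun h => by rw [h, mul_zero]⟩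
      exact orderOf_dvd_iff_pow_eq_one.2 ((mul_eq_right₀ hx).1 h)
    rw [hzero, Nat.card_unique]

theorem exists_orderOf_eq_of_dvd_natCard_sub_one (K : Type*) [Field K] [Finite K] {e : ℕ}
    (he : e ∣ Nat.card K - 1) : ∃ a : K, orderOf a = e := by
  obtain ⟨g, hg⟩ := IsCyclic.exists_ofOrder_eq_natCard (α := Kˣ)
  rw [← Nat.card_units, ← hg] at he
  obtain ⟨t, ht⟩ := he
  have ht0 : t ≠ 0 := fun h0 => (orderOf_pos g).ne' (by rw [ht, h0, mul_zero])
  refine ⟨(g ^ t : Kˣ), ?_⟩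
  rw [orderOf_units, orderOf_pow_of_dvd ht0 (Dvd.intro_left _ ht.symm), ht,
    Nat.mul_div_cancel _ (Nat.pos_of_ne_zero ht0)]

theorem semiconj_conj {R V W : Type*} [CommSemiring R] [AddCommMonoid V] [AddCommMonoid W]
    [Module R V] [Module R W] (e : V ≃ₗ[R] W) (T : V →ₗ[R] V) :
    Semiconj e.toEquiv T (e.conj T) := fun x => by
  simp [LinearEquiv.conj_apply_apply]

theorem exists_natCard_ptsOfPeriod_eq_pow_ite (F : Type*) [Field F] [Finite F] {d e : ℕ}
    (hd : 0 < d) (he : e ∣ Nat.card F ^ d - 1) : ∃ T : (Fin d → F) →ₗ[F] (Fin d → F), ∀ m,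
      Nat.card (ptsOfPeriod T m) = Nat.card F ^ (if e ∣ m then d else 0) := by
  obtain ⟨p, hp⟩ := CharP.exists F
  have : Fact p.Prime := ⟨CharP.char_is_prime F p⟩
  have : NeZero d := ⟨hd.ne'⟩
  let K := FiniteField.Extension F p d
  have hcard : Nat.card K = Nat.card F ^ d := FiniteField.natCard_extension F p d
  have : Finite K := Module.finite_of_finite F
  obtain ⟨a, ha⟩ := exists_orderOf_eq_of_dvd_natCard_sub_one K (e := e) (by rwa [hcard])
  let toPi : K ≃ₗ[F] (Fin d → F) := LinearEquiv.ofFinrankEq _ _ <| by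
    rw [Module.finrank_fin_fun]
    exact FiniteField.finrank_extension F p d
  refine ⟨toPi.conj (LinearMap.mulLeft F a), fun m => ?_⟩
  rw [← natCard_ptsOfPeriod_eq_of_semiconj (semiconj_conj toPi (LinearMap.mulLeft F a)), ← ha,
    pow_ite, pow_zero, ← hcard]
  exact natCard_ptsOfPeriod_mul_left a m

theorem exists_natCard_ptsOfPeriod_eq_prod {F ι : Type*} [Field F] [Fintype ι] {V : ι → Type*}
    [∀ i, AddCommGroup (V i)] [∀ i, Module F (V i)] [∀ i, FiniteDimensional F (V i)]
    (T : ∀ i, V i →ₗ[F] V i) {n : ℕ} (hn : ∑ i, Module.finrank F (V i) ≤ n) :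
    ∃ S : (Fin n → F) →ₗ[F] (Fin n → F), ∀ m, 0 < m →
      Nat.card (ptsOfPeriod S m) = ∏ i, Nat.card (ptsOfPeriod (T i) m) := by
  let W := (∀ i, V i) × (Fin (n - ∑ i, Module.finrank F (V i)) → F)
  let toPi : W ≃ₗ[F] (Fin n → F) := LinearEquiv.ofFinrankEq _ _ <| by
    rw [Module.finrank_prod, Module.finrank_pi_fintype, Module.finrank_fin_fun,
      Module.finrank_fin_fun, Nat.add_sub_cancel' hn]
  let S : W →ₗ[F] W := (LinearMap.piMap T).prodMap 0
  refine ⟨toPi.conj S, fun m hm => ?_⟩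
  rw [← natCard_ptsOfPeriod_eq_of_semiconj (semiconj_conj toPi S), ← natCard_ptsOfPeriod_piMap]
  refine (natCard_ptsOfPeriod_prodMap (Pi.map fun i => T i) 0 m).trans ?_
  exact (congrArg _ (natCard_ptsOfPeriod_zero hm)).trans (mul_one _)

theorem sum_sigma_sigma_fin {κ ι : Type*} [Fintype κ] (D : κ → Finset ι) (c g : κ → ι → ℕ) :
    ∑ i : Σ k, Σ e : D k, Fin (c k e), g i.1 i.2.1 = ∑ k, ∑ e ∈ D k, c k e * g k e := by
  simp only [← Finset.univ_sigma_univ, Finset.sum_sigma, Finset.sum_const, Finset.card_univ,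
    Fintype.card_fin, smul_eq_mul]
  exact Finset.sum_congr rfl fun k _ => Finset.sum_coe_sort (D k) fun e => c k e * g k e

theorem exists_natCard_ptsOfPeriod_eq_pow (F : Type*) [Field F] [Finite F] {n : ℕ}
    {D : Fin n → Finset ℕ} (hD : ∀ k, D k ⊆ (Nat.card F ^ ((k : ℕ) + 1) - 1).divisors)
    {c : Fin n → ℕ → ℕ} (hc : weight (fun k => ∑ e ∈ D k, c k e) ≤ n) :
    ∃ T : (Fin n → F) →ₗ[F] (Fin n → F), ∀ m, 0 < m → Nat.card (ptsOfPeriod T m) =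
      Nat.card F ^ ∑ k, ∑ e ∈ D k with e ∣ m, c k e * ((k : ℕ) + 1) := by
  choose block hblock using fun (k : Fin n) (e : D k) =>
    exists_natCard_ptsOfPeriod_eq_pow_ite F (Nat.succ_pos k) (Nat.dvd_of_mem_divisors (hD k e.2))
  have hdim : ∑ i : Σ k : Fin n, Σ e : D k, Fin (c k e),
      Module.finrank F (Fin ((i.1 : ℕ) + 1) → F) = weight fun k => ∑ e ∈ D k, c k e := by
    simp only [Module.finrank_fin_fun, weight, Finset.sum_mul]
    exact sum_sigma_sigma_fin D c fun k _ => (k : ℕ) + 1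
  obtain ⟨T, hT⟩ := exists_natCard_ptsOfPeriod_eq_prod
    (fun i : Σ k : Fin n, Σ e : D k, Fin (c k e) => block i.1 i.2.1) (hdim.trans_le hc)
  refine ⟨T, fun m hm => ?_⟩
  simp only [hT m hm, hblock, Finset.prod_pow_eq_pow_sum]
  rw [sum_sigma_sigma_fin D c fun k e => if e ∣ m then (k : ℕ) + 1 else 0]
  simp only [mul_ite, mul_zero, Finset.sum_filter]

end SemisimpleMaps

section LowerBound

theorem eq_of_sum_filter_dvd_eq {κ M : Type*} [Fintype κ] [AddCancelCommMonoid M]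
    {D : κ → Finset ℕ} (hpos : ∀ k, ∀ e ∈ D k, 0 < e) (hdisj : Pairwise (Disjoint on D))
    {f g : κ → ℕ → M} (h : ∀ m, 0 < m →
      ∑ k, ∑ e ∈ D k with e ∣ m, f k e = ∑ k, ∑ e ∈ D k with e ∣ m, g k e)
    {k : κ} {e : ℕ} (he : e ∈ D k) : f k e = g k e := by
  have hcomm : ∀ m, 0 < m → ∀ f : κ → ℕ → M, ∑ k, ∑ e ∈ D k with e ∣ m, f k e =
      ∑ e ∈ m.divisors, ∑ k with e ∈ D k, f k e := fun m hm f =>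
    Finset.sum_comm' fun k e => by simp [hm.ne', and_comm]
  have hfiber : ({k' | e ∈ D k'} : Finset κ) = {k} := Finset.ext fun k' => by
    simp only [Finset.mem_filter, Finset.mem_univ, true_and, Finset.mem_singleton]
    exact ⟨fun he' => hdisj.eq (Finset.not_disjoint_iff.2 ⟨e, he', he⟩), fun hk => hk ▸ he⟩
  have heq := eq_of_sum_divisors_eq
    (fun m hm => (hcomm m hm f).symm.trans ((h m hm).trans (hcomm m hm g))) (hpos k e he)
  simpa only [hfiber, Finset.sum_singleton] using heq

/-- The moduli `e` for which `q` has order `i`. -/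
noncomputable def moduliOfOrder (q i : ℕ) : Finset ℕ :=
  {e ∈ (q ^ i - 1).divisors | orderOf (q : ZMod e) = i}

theorem isLeast_pow_modEq_one_iff {q i e : ℕ} (hi : 0 < i) :
    IsLeast {j | 0 < j ∧ q ^ j ≡ 1 [MOD e]} i ↔ orderOf (q : ZMod e) = i := by
  have hpow : ∀ j, q ^ j ≡ 1 [MOD e] ↔ (q : ZMod e) ^ j = 1 := fun j => by
    rw [← ZMod.natCast_eq_natCast_iff, Nat.cast_pow, Nat.cast_one]
  simp only [orderOf_eq_iff hi, IsLeast, mem_lowerBounds, Set.mem_ofPred_eq, hpow]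
  grind

theorem mem_moduliOfOrder {q i e : ℕ} (hq : 1 < q) (hi : 0 < i) :
    e ∈ moduliOfOrder q i ↔ 0 < e ∧ orderOf (q : ZMod e) = i := by
  have hpos : 0 < q ^ i - 1 := Nat.sub_pos_of_lt (Nat.one_lt_pow hi.ne' hq)
  rw [moduliOfOrder, Finset.mem_filter, Nat.mem_divisors]
  refine and_congr_left fun horder => ⟨fun h => Nat.pos_of_dvd_of_pos h.1 hpos, fun _ => ?_⟩
  refine ⟨(Nat.modEq_iff_dvd' (Nat.one_le_pow _ _ (by omega))).1 ?_, hpos.ne'⟩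
  exact ((isLeast_pow_modEq_one_iff hi).2 horder).1.2.symm

theorem card_moduliOfOrder {q i : ℕ} (hq : 1 < q) (hi : 0 < i) :
    (moduliOfOrder q i).card = numModuliOfOrder q i := by
  rw [numModuliOfOrder, ← Set.ncard_coe_finset]
  congr 1
  ext e
  rw [Finset.mem_coe, mem_moduliOfOrder hq hi, Set.mem_ofPred_eq, isLeast_pow_modEq_one_iff hi]

theorem eq_of_mem_multisetFamilies {κ ι : Type*} [Fintype κ] [DecidableEq κ] [DecidableEq ι]
    {D : κ → Finset ι} {lam lam' : κ → ℕ} {c c' : κ → ι → ℕ} (hc : c ∈ multisetFamilies D lam)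
    (hc' : c' ∈ multisetFamilies D lam') (h : ∀ k, ∀ i ∈ D k, c k i = c' k i) :
    lam = lam' ∧ c = c' := by
  rw [mem_multisetFamilies] at hc hc'
  refine ⟨funext fun k => ?_, funext fun k => funext fun i => ?_⟩
  · rw [← (hc k).1, ← (hc' k).1, Finset.sum_congr rfl (h k)]
  · by_cases hi : i ∈ D k
    · exact h k i hi
    · rw [not_ne_iff.1 (mt ((hc k).2 i) hi), not_ne_iff.1 (mt ((hc' k).2 i) hi)]

theorem pairwise_disjoint_moduliOfOrder {q : ℕ} (hq : 1 < q) (n : ℕ) :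
    Pairwise (Disjoint on fun k : Fin n => moduliOfOrder q ((k : ℕ) + 1)) := fun _ _ hne =>
  Finset.disjoint_left.2 fun _ he he' => hne <| Fin.ext <| Nat.succ_injective <|
    ((mem_moduliOfOrder hq (Nat.succ_pos _)).1 he).2.symm.trans
      ((mem_moduliOfOrder hq (Nat.succ_pos _)).1 he').2

theorem sum_le_numFunctionalGraphs (F : Type*) [Field F] [Finite F] (n : ℕ) :
    ∑ lam ∈ boundedWeightVectors n, ∏ k : Fin n,
      (numModuliOfOrder (Nat.card F) ((k : ℕ) + 1) + lam k - 1).choose (lam k) ≤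
      numFunctionalGraphs F n := by
  have hq : 1 < Nat.card F := Finite.one_lt_card
  let D : Fin n → Finset ℕ := fun k => moduliOfOrder (Nat.card F) ((k : ℕ) + 1)
  let families : Finset (Σ _ : Fin n → ℕ, Fin n → ℕ → ℕ) :=
    (boundedWeightVectors n).sigma (multisetFamilies D)
  have hgraph : ∀ p ∈ families, ∃ T : (Fin n → F) →ₗ[F] (Fin n → F), ∀ m, 0 < m →
      Nat.card (ptsOfPeriod T m) =
        Nat.card F ^ ∑ k, ∑ e ∈ D k with e ∣ m, p.2 k e * ((k : ℕ) + 1) := fun p hp => by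
    obtain ⟨hlam, hc⟩ := Finset.mem_sigma.1 hp
    refine exists_natCard_ptsOfPeriod_eq_pow F (D := D) (fun _ => Finset.filter_subset _ _) ?_
    rw [funext fun k => (mem_multisetFamilies.1 hc k).1]
    exact (mem_boundedWeightVectors.1 hlam).2
  choose! T hT using hgraph
  have : Finite ((Fin n → F) →ₗ[F] (Fin n → F)) := Module.finite_of_finite F
  have : Finite (Quotient (functionalGraphSetoid F n)) := inferInstance
  suffices h : families.card ≤ numFunctionalGraphs F n by
    simpa only [families, D, Finset.card_sigma, card_multisetFamilies,
      card_moduliOfOrder hq (Nat.succ_pos _)] using h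
  refine card_le_natCard_quotient (f := T) fun p hp p' hp' hiso => ?_
  obtain ⟨φ, hφ⟩ := functionalGraph_isIsomorphic_iff.1 hiso
  have hexp : ∀ m, 0 < m → ∑ k, ∑ e ∈ D k with e ∣ m, p.2 k e * ((k : ℕ) + 1) =
      ∑ k, ∑ e ∈ D k with e ∣ m, p'.2 k e * ((k : ℕ) + 1) := fun m hm => by
    refine Nat.pow_right_injective hq ?_
    dsimp only
    rw [← hT p hp m hm, ← hT p' hp' m hm]
    exact natCard_ptsOfPeriod_eq_of_semiconj hφ m
  have hcount : ∀ k, ∀ e ∈ D k, p.2 k e = p'.2 k e := fun k e he =>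
    Nat.eq_of_mul_eq_mul_right (Nat.succ_pos k) <| eq_of_sum_filter_dvd_eq
      (fun _ _ he => ((mem_moduliOfOrder hq (Nat.succ_pos _)).1 he).1)
      (pairwise_disjoint_moduliOfOrder hq n) hexp he
  obtain ⟨hlam, hc⟩ :=
    eq_of_mem_multisetFamilies (Finset.mem_sigma.1 hp).2 (Finset.mem_sigma.1 hp').2 hcount
  exact Sigma.ext hlam (heq_of_eq hc)

end LowerBound

section Partitions

theorem card_weightVectors_le_card_partition (n m : ℕ) :
    (weightVectors n m).card ≤ Fintype.card m.Partition := by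
  let parts : (Fin n → ℕ) → Multiset ℕ := fun a => ∑ k, Multiset.replicate (a k) ((k : ℕ) + 1)
  have hcount : ∀ a (k : Fin n), (parts a).count ((k : ℕ) + 1) = a k := fun a k => by
    simp [parts, Multiset.count_sum', Multiset.count_replicate, Fin.val_inj]
  have hsum : ∀ a, (parts a).sum = weight a := fun a => by
    rw [← Multiset.coe_sumAddMonoidHom, map_sum]
    simp only [Multiset.coe_sumAddMonoidHom, Multiset.sum_replicate, smul_eq_mul, weight]
  have hpos : ∀ a, ∀ {i}, i ∈ parts a → 0 < i := fun a i hi => by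
    obtain ⟨k, -, hk⟩ := Multiset.mem_sum.1 hi
    exact Multiset.eq_of_mem_replicate hk ▸ Nat.succ_pos _
  let partition : weightVectors n m → m.Partition := fun a =>
    ⟨parts a, hpos a, (hsum a).trans (mem_weightVectors.1 a.2)⟩
  have hinj : Injective partition := fun a b hab => by
    have hparts : parts a = parts b := congrArg Nat.Partition.parts hab
    exact Subtype.ext (funext fun k => by rw [← hcount a k, hparts, hcount])
  simpa only [Fintype.card_coe] using Fintype.card_le_of_injective _ hinj

theorem card_weightVectors_le_two_pow (n m : ℕ) : (weightVectors n m).card ≤ 2 ^ (m - 1) := by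
  rw [← composition_card]
  exact (card_weightVectors_le_card_partition n m).trans
    (Fintype.card_le_of_surjective _ Nat.Partition.ofComposition_surj)

theorem geom_sum_le_inv_one_sub {x : ℝ} (hx0 : 0 ≤ x) (hx1 : x < 1) (n : ℕ) :
    ∑ j ∈ Finset.range n, x ^ j ≤ (1 - x)⁻¹ := by
  rw [← tsum_geometric_of_lt_one hx0 hx1]
  exact (summable_geometric_of_lt_one hx0 hx1).sum_le_tsum _ fun _ _ => by positivity

theorem card_weightVectors_mul_pow_le (n m : ℕ) {x : ℝ} (hx0 : 0 ≤ x) (hx1 : x < 1) :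
    (weightVectors n m).card * x ^ m ≤ ∏ k : Fin n, (1 - x ^ ((k : ℕ) + 1))⁻¹ := by
  calc (weightVectors n m).card * x ^ m
      = ∑ a ∈ weightVectors n m, ∏ k : Fin n, (x ^ ((k : ℕ) + 1)) ^ a k := by
        rw [← nsmul_eq_mul, ← Finset.sum_const]
        refine Finset.sum_congr rfl fun a ha => ?_
        simp only [← mem_weightVectors.1 ha, weight, mul_comm (a _), ← pow_mul,
          Finset.prod_pow_eq_pow_sum]
    _ ≤ ∑ a ∈ Fintype.piFinset fun _ : Fin n => Finset.range (m + 1),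
          ∏ k : Fin n, (x ^ ((k : ℕ) + 1)) ^ a k :=
        Finset.sum_le_sum_of_subset_of_nonneg (Finset.filter_subset _ _)
          fun _ _ _ => Finset.prod_nonneg fun _ _ => by positivity
    _ = ∏ k : Fin n, ∑ j ∈ Finset.range (m + 1), (x ^ ((k : ℕ) + 1)) ^ j :=
        (Finset.prod_univ_sum (fun _ => Finset.range (m + 1))
          fun (k : Fin n) j => (x ^ ((k : ℕ) + 1)) ^ j).symm
    _ ≤ ∏ k : Fin n, (1 - x ^ ((k : ℕ) + 1))⁻¹ :=
        Finset.prod_le_prod (fun _ _ => Finset.sum_nonneg fun _ _ => by positivity) fun k _ =>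
          geom_sum_le_inv_one_sub (pow_nonneg hx0 _) (pow_lt_one₀ hx0 hx1 (Nat.succ_ne_zero k)) _

theorem hasSum_log_prod_inv_one_sub_pow (n : ℕ) {x : ℝ} (hx0 : 0 ≤ x) (hx1 : x < 1) :
    HasSum (fun j : ℕ => (∑ k : Fin n, (x ^ (j + 1)) ^ ((k : ℕ) + 1)) / ((j : ℝ) + 1))
      (Real.log (∏ k : Fin n, (1 - x ^ ((k : ℕ) + 1))⁻¹)) := by
  have hlt : ∀ k : Fin n, x ^ ((k : ℕ) + 1) < 1 := fun k =>
    pow_lt_one₀ hx0 hx1 (Nat.succ_ne_zero k)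
  have hlog : ∀ k : Fin n, HasSum (fun j : ℕ => (x ^ ((k : ℕ) + 1)) ^ (j + 1) / ((j : ℝ) + 1))
      (Real.log (1 - x ^ ((k : ℕ) + 1))⁻¹) := fun k => by
    rw [Real.log_inv]
    refine Real.hasSum_pow_div_log_of_abs_lt_one ?_
    rw [abs_of_nonneg (by positivity)]
    exact hlt k
  rw [Real.log_prod fun k _ => (inv_pos.2 (sub_pos.2 (hlt k))).ne']
  simpa only [Finset.sum_div, pow_right_comm x] using hasSum_sum fun k _ => hlog k

theorem exp_neg_div_one_sub_exp_neg_le {t : ℝ} (ht : 0 < t) :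
    Real.exp (-t) / (1 - Real.exp (-t)) ≤ 1 / t := by
  have hlt : 0 < 1 - Real.exp (-t) := sub_pos.2 (Real.exp_lt_one_iff.2 (neg_lt_zero.2 ht))
  have hexp : Real.exp (-t) * (t + 1) ≤ 1 := by
    calc Real.exp (-t) * (t + 1) ≤ Real.exp (-t) * Real.exp t := by
          gcongr
          exact Real.add_one_le_exp t
      _ = 1 := by rw [← Real.exp_add, neg_add_cancel, Real.exp_zero]
  rw [div_le_div_iff₀ hlt ht]
  linarith

theorem sum_exp_neg_pow_le (n : ℕ) {t : ℝ} (ht : 0 < t) :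
    ∑ k : Fin n, Real.exp (-t) ^ ((k : ℕ) + 1) ≤ 1 / t := by
  calc ∑ k : Fin n, Real.exp (-t) ^ ((k : ℕ) + 1)
      = Real.exp (-t) * ∑ k ∈ Finset.range n, Real.exp (-t) ^ k := by
        rw [Fin.sum_univ_eq_sum_range fun k => Real.exp (-t) ^ (k + 1), Finset.mul_sum]
        simp only [pow_succ']
    _ ≤ Real.exp (-t) / (1 - Real.exp (-t)) := by
        rw [div_eq_mul_inv]
        gcongr
        exact geom_sum_le_inv_one_sub (Real.exp_nonneg _)
          (Real.exp_lt_one_iff.2 (neg_lt_zero.2 ht)) n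
    _ ≤ 1 / t := exp_neg_div_one_sub_exp_neg_le ht

theorem prod_inv_one_sub_exp_neg_pow_le (n : ℕ) {t : ℝ} (ht : 0 < t) :
    ∏ k : Fin n, (1 - Real.exp (-t) ^ ((k : ℕ) + 1))⁻¹ ≤ Real.exp (Real.pi ^ 2 / 6 / t) := by
  have hlt : Real.exp (-t) < 1 := Real.exp_lt_one_iff.2 (neg_lt_zero.2 ht)
  have hpos : ∀ k : Fin n, 0 < (1 - Real.exp (-t) ^ ((k : ℕ) + 1))⁻¹ := fun k =>
    inv_pos.2 (sub_pos.2 (pow_lt_one₀ (Real.exp_nonneg _) hlt (Nat.succ_ne_zero k)))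
  have hzeta : HasSum (fun j : ℕ => 1 / ((j : ℝ) + 1) ^ 2 / t) (Real.pi ^ 2 / 6 / t) := by
    simpa using ((hasSum_nat_add_iff' 1).2 hasSum_zeta_two).div_const t
  rw [← Real.log_le_iff_le_exp (Finset.prod_pos fun k _ => hpos k)]
  refine hasSum_le (fun j => ?_)
    (hasSum_log_prod_inv_one_sub_pow n (Real.exp_nonneg _) hlt) hzeta
  have hterm := sum_exp_neg_pow_le n (t := ((j : ℝ) + 1) * t) (by positivity)
  have hexp : Real.exp (-t) ^ (j + 1) = Real.exp (-(((j : ℝ) + 1) * t)) := by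
    rw [← Real.exp_nat_mul]
    push_cast
    ring_nf
  calc (∑ k : Fin n, (Real.exp (-t) ^ (j + 1)) ^ ((k : ℕ) + 1)) / ((j : ℝ) + 1)
      ≤ 1 / (((j : ℝ) + 1) * t) / ((j : ℝ) + 1) := by
        rw [hexp]
        gcongr
    _ = 1 / ((j : ℝ) + 1) ^ 2 / t := by
        field_simp

theorem card_weightVectors_le_exp_add (n m : ℕ) {t : ℝ} (ht : 0 < t) :
    ((weightVectors n m).card : ℝ) ≤ Real.exp (Real.pi ^ 2 / 6 / t + t * m) := by
  have hprod := (card_weightVectors_mul_pow_le n m (Real.exp_nonneg (-t))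
    (Real.exp_lt_one_iff.2 (neg_lt_zero.2 ht))).trans (prod_inv_one_sub_exp_neg_pow_le n ht)
  rwa [← Real.exp_nat_mul, mul_neg, Real.exp_neg, ← div_eq_mul_inv, div_le_iff₀ (Real.exp_pos _),
    ← Real.exp_add, mul_comm (m : ℝ)] at hprod

theorem card_weightVectors_le_exp_sqrt (n m : ℕ) :
    ((weightVectors n m).card : ℝ) ≤ Real.exp (Real.pi * √(2 * m / 3)) := by
  rcases m.eq_zero_or_pos with rfl | hm
  · simpa using card_weightVectors_le_two_pow n 0
  · set s := √(2 * (m : ℝ) / 3) with hs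
    have hs0 : 0 < s := Real.sqrt_pos.2 (by positivity)
    have hm_eq : (m : ℝ) = 3 * s ^ 2 / 2 := by
      rw [hs, Real.sq_sqrt (by positivity)]
      ring
    refine (card_weightVectors_le_exp_add n m (t := Real.pi / (3 * s)) (by positivity)).trans_eq ?_
    rw [hm_eq]
    congr 1
    field_simp
    ring

theorem two_mul_card_weightVectors_le {n m : ℕ} (hn : 0 < n) (hmn : m ≤ n) :
    2 * ((weightVectors n m).card : ℝ) ≤ 2 ^ (4 * √(n : ℝ)) := by
  have hsq : √(n : ℝ) ^ 2 = n := Real.sq_sqrt (Nat.cast_nonneg n)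
  rcases le_total n 16 with h16 | h16
  · have hsqrt : √(n : ℝ) ≤ 4 := Real.sqrt_le_iff.2 ⟨by norm_num, by norm_num; exact_mod_cast h16⟩
    calc 2 * ((weightVectors n m).card : ℝ) ≤ 2 * 2 ^ (n - 1) := by
          gcongr
          exact_mod_cast (card_weightVectors_le_two_pow n m).trans
            (Nat.pow_le_pow_right two_pos (Nat.sub_le_sub_right hmn 1))
      _ = 2 ^ (n : ℝ) := by rw [mul_pow_sub_one hn.ne', Real.rpow_natCast]
      _ ≤ 2 ^ (4 * √(n : ℝ)) := Real.rpow_le_rpow_of_exponent_le one_le_two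
          (by nlinarith [Real.sqrt_nonneg (n : ℝ)])
  · have hsqrt : 4 ≤ √(n : ℝ) := Real.le_sqrt_of_sq_le (by norm_num; exact_mod_cast h16)
    have hlog : 0.693 ≤ Real.log 2 := by linarith [Real.log_two_gt_d9]
    have hexponent : Real.pi * √(2 * m / 3) ≤ 15 / 4 * Real.log 2 * √(n : ℝ) := by
      refine abs_le_of_sq_le_sq' ?_ (by positivity) |>.2
      rw [mul_pow, mul_pow, Real.sq_sqrt (by positivity), hsq]
      have hpi : Real.pi ^ 2 * (2 / 3) ≤ (15 / 4 * Real.log 2) ^ 2 := by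
        nlinarith [Real.pi_lt_d4, Real.pi_pos]
      have hmn' : (m : ℝ) ≤ n := Nat.cast_le.2 hmn
      nlinarith [sq_nonneg Real.pi]
    calc 2 * ((weightVectors n m).card : ℝ)
        ≤ Real.exp (Real.log 2) * Real.exp (Real.pi * √(2 * m / 3)) := by
          rw [Real.exp_log two_pos]
          gcongr
          exact card_weightVectors_le_exp_sqrt n m
      _ ≤ Real.exp (Real.log 2 * (4 * √(n : ℝ))) := by
          rw [← Real.exp_add]
          refine Real.exp_le_exp.2 ?_
          nlinarith
      _ = 2 ^ (4 * √(n : ℝ)) := (Real.rpow_def_of_pos two_pos _).symm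

end Partitions

theorem numDivisors_pos {q i : ℕ} (hq : 1 < q) (hi : i ≠ 0) : 0 < numDivisors q i :=
  Finset.card_pos.2 (Nat.nonempty_divisors.2 (Nat.sub_pos_of_lt (Nat.one_lt_pow hi hq)).ne')

theorem one_le_sum_boundedWeightVectors {n : ℕ} (hn : 0 < n) {s : Fin n → ℕ} (hs : ∀ k, 0 < s k) :
    1 ≤ ∑ lam ∈ boundedWeightVectors n, ∏ k, (s k + lam k - 1).choose (lam k) := by
  let lam : Fin n → ℕ := Pi.single ⟨0, hn⟩ 1
  have hmem : lam ∈ boundedWeightVectors n := by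
    refine mem_boundedWeightVectors.2 ⟨by simp [lam], ?_⟩
    rw [Finset.sum_eq_single ⟨0, hn⟩ (fun k _ hk => by simp [lam, hk]) (by simp)]
    simpa [lam] using Nat.one_le_iff_ne_zero.2 hn.ne'
  have hchoose : ∀ k, 0 < (s k + lam k - 1).choose (lam k) := fun k =>
    Nat.choose_pos (by have := hs k; omega)
  exact (Finset.prod_pos fun k _ => hchoose k).trans_le
    (Finset.single_le_sum (f := fun lam => ∏ k, (s k + lam k - 1).choose (lam k))
      (fun _ _ => Nat.zero_le _) hmem)

theorem sum_insert_zero_boundedWeightVectors_le {n : ℕ} (hn : 0 < n) {s : Fin n → ℕ}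
    (hs : ∀ k, 0 < s k) :
    ∑ lam ∈ insert 0 (boundedWeightVectors n), ∏ k, (s k + lam k - 1).choose (lam k) ≤
      2 * ∑ lam ∈ boundedWeightVectors n, ∏ k, (s k + lam k - 1).choose (lam k) := by
  rw [Finset.sum_insert fun h => (mem_boundedWeightVectors.1 h).1 rfl]
  have hone := one_le_sum_boundedWeightVectors hn hs
  simp only [Pi.zero_apply, Nat.choose_zero_right, Finset.prod_const_one]
  omega

theorem theorem1 (q : ℕ) (hq : IsPrimePow q) (F : Type*) [Field F] [Finite F]
    (hF : Nat.card F = q) (n : ℕ) (hn : 0 < n) :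
    (∑ lam ∈ boundedWeightVectors n, ∏ k : Fin n,
        (numModuliOfOrder q ((k : ℕ) + 1) + lam k - 1).choose (lam k)) ≤
      numFunctionalGraphs F n ∧
    (numFunctionalGraphs F n : ℝ) ≤
      (2 : ℝ) ^ (4 * Real.sqrt (n : ℝ)) *
        ((∑ lam ∈ boundedWeightVectors n, ∏ k : Fin n,
          (numDivisors q ((k : ℕ) + 1) + lam k - 1).choose (lam k) : ℕ) : ℝ) := by
  subst hF
  refine ⟨sum_le_numFunctionalGraphs F n, ?_⟩
  let B : ℝ := 2 ^ (4 * √(n : ℝ))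
  let types : (Fin n → ℕ) → ℕ := fun lam => ∏ k : Fin n,
    (numDivisors (Nat.card F) ((k : ℕ) + 1) + lam k - 1).choose (lam k)
  have hdouble : ∑ lam ∈ insert 0 (boundedWeightVectors n), types lam ≤
      2 * ∑ lam ∈ boundedWeightVectors n, types lam :=
    sum_insert_zero_boundedWeightVectors_le hn fun k =>
      numDivisors_pos Finite.one_lt_card (Nat.succ_ne_zero k)
  calc (numFunctionalGraphs F n : ℝ)
      ≤ ∑ lam ∈ insert 0 (boundedWeightVectors n),
          ((weightVectors n (n - weight lam)).card : ℝ) * types lam :=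
        mod_cast numFunctionalGraphs_le F n
    _ ≤ ∑ lam ∈ insert 0 (boundedWeightVectors n), B / 2 * types lam := by
        gcongr with lam
        exact (le_div_iff₀' two_pos).2 (two_mul_card_weightVectors_le hn (Nat.sub_le _ _))
    _ = B / 2 * (∑ lam ∈ insert 0 (boundedWeightVectors n), types lam : ℕ) := by
        rw [← Finset.mul_sum, Nat.cast_sum]
    _ ≤ B / 2 * (2 * ∑ lam ∈ boundedWeightVectors n, types lam : ℕ) := by gcongr
    _ = B * (∑ lam ∈ boundedWeightVectors n, types lam : ℕ) := by push_cast; ring
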